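/- Let $T$ be a finite tree on $n\ge 3$ vertices that is twin-free, i.e. no two distinct vertices $u,v$ of $T$ satisfy $N(u)=N(v)$ or $N[u]=N[v]$, where $N(v)$ is the set of neighbours of $v$ and $N[v]=N(v)\cup\{v\}$. A total dominating identifying code of $T$ is a set $C\subseteq V(T)$ such that every vertex of $T$ has a neighbour in $C$ and $N[u]\cap C\ne N[v]\cap C$ for all distinct vertices $u,v$. Then $T$ admits a total dominating identifying code, and the smallest size $\gamma_t^{\mathrm{ID}}(T)$ of such a code satisfies $$\gamma_t^{\mathrm{ID}}(T)\le \frac{3n}{4}.$$ -/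

import Mathlib

namespace SimpleGraph

/-- The closed neighbourhood `N[v] = N(v) ∪ {v}`. -/
def closedNbhd {V : Type*} (G : SimpleGraph V) (v : V) : Set V :=
  insert v (G.neighborSet v)

/-- `u` and `v` are open twins: distinct vertices with the same open neighbourhood. -/
def OpenTwins {V : Type*} (G : SimpleGraph V) (u v : V) : Prop :=
  u ≠ v ∧ G.neighborSet u = G.neighborSet v

/-- `u` and `v` are closed twins: distinct vertices with the same closed neighbourhood. -/
def ClosedTwins {V : Type*} (G : SimpleGraph V) (u v : V) : Prop :=
  u ≠ v ∧ G.closedNbhd u = G.closedNbhd v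

/-- A graph is twin-free if it contains neither open nor closed twins. -/
def TwinFree {V : Type*} (G : SimpleGraph V) : Prop :=
  ∀ u v : V, ¬ G.OpenTwins u v ∧ ¬ G.ClosedTwins u v

/-- The `I`-set of `v` with respect to the code `C`, namely `N[v] ∩ C`. -/
def iSet {V : Type*} (G : SimpleGraph V) (C : Finset V) (v : V) : Set V :=
  G.closedNbhd v ∩ (C : Set V)

/-- `C` is a separating code: distinct vertices have distinct `I`-sets. -/
def IsSeparatingCode {V : Type*} (G : SimpleGraph V) (C : Finset V) : Prop :=
  ∀ u v : V, u ≠ v → G.iSet C u ≠ G.iSet C v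

/-- `C` is a total dominating set: every vertex has a neighbour in `C`. -/
def IsTotalDominatingSet {V : Type*} (G : SimpleGraph V) (C : Finset V) : Prop :=
  ∀ v : V, ∃ c ∈ C, G.Adj v c

/-- `C` is a total dominating identifying code: a separating code that is also a total
dominating set. -/
def IsTotalDominatingIdentifyingCode {V : Type*} (G : SimpleGraph V) (C : Finset V) : Prop :=
  G.IsSeparatingCode C ∧ G.IsTotalDominatingSet C

/-- The smallest size of a total dominating identifying code of `G`. It is meaningful only for
graphs that admit such a code (otherwise it has the default value `0`). -/
noncomputable def totalDominatingIdentifyingNumber {V : Type*} (G : SimpleGraph V) : ℕ :=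
  sInf {k : ℕ | ∃ C : Finset V, G.IsTotalDominatingIdentifyingCode C ∧ C.card = k}

end SimpleGraph

/-!
Root the tree `T` at a leaf `r` and let `D` be one of the four classes of vertices whose distance
to `r` has a fixed residue modulo `4`; the largest class has at least `n / 4` elements. The
complement of `D` is almost a code: `D` is independent, and in a tree without twins the complement
`C` of an independent set is a total dominating identifying code as soon as every component of
`T[C]` has at least three vertices (`IsLevelling.isCode_of_onPath3`). Indeed, adjacent vertices
fail to be separated only if they form a component of `T[C]`, and two vertices at distance two fail
only if both are leaves at their common neighbour.

For a residue class, the components of `T - D` with at most two vertices are harmless: such a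
component is a single leaf of `T` or an edge one of whose ends is a leaf of `T`
(`IsLevelling.isLeafAt_of_isolated`, `IsLevelling.isLeafAt_of_isolated_edge`). They are removed by
an exchange (`exists_independent_onPath3`). Every small component is adjacent to a vertex of `D`,
its anchor: all anchors leave `D`, and the leaves of the small components enter `D` instead. An
exception is a single-leaf component whose neighbour is already the anchor of an edge component;
its leaf stays outside. Every anchor is traded for at least one leaf, so `D` does not shrink, and
afterwards every vertex outside `D` lies on a path of three vertices outside `D`.
-/

namespace SimpleGraph

variable {V : Type*} {G : SimpleGraph V}

/-! ### Leaves and paths of three vertices -/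

/-- `x` is a leaf whose only neighbour is `p`. -/
def IsLeafAt (G : SimpleGraph V) (x p : V) : Prop :=
  ∀ w, G.Adj x w ↔ w = p

/-- `v` lies on a path `a - b - c` of three distinct vertices of `C`. As the path may be reversed,
`v` is only allowed to be `a` or `b`. This says that the component of `v` in the subgraph induced
by `C` has at least three vertices. -/
def OnPath3 (G : SimpleGraph V) (C : Set V) (v : V) : Prop :=
  ∃ a b c, a ∈ C ∧ b ∈ C ∧ c ∈ C ∧ a ≠ c ∧ G.Adj a b ∧ G.Adj b c ∧ (v = a ∨ v = b)

theorem OnPath3.exists_adj {C : Set V} {v : V} (h : G.OnPath3 C v) : ∃ c ∈ C, G.Adj v c := by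
  obtain ⟨a, b, c, ha, hb, hc, -, hab, hbc, rfl | rfl⟩ := h
  · exact ⟨b, hb, hab⟩
  · exact ⟨c, hc, hbc⟩

theorem TwinFree.eq_of_isLeafAt (h : G.TwinFree) {x y p : V} (hx : G.IsLeafAt x p)
    (hy : G.IsLeafAt y p) : x = y := by
  by_contra hne
  refine (h x y).1 ⟨hne, ?_⟩
  ext w
  simp only [mem_neighborSet, hx w, hy w]

theorem TwinFree.not_isLeafAt_swap (h : G.TwinFree) {x y : V} (hx : G.IsLeafAt x y) :
    ¬ G.IsLeafAt y x := by
  intro hy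
  refine (h x y).2 ⟨((hx y).2 rfl).ne, ?_⟩
  ext w
  simp only [closedNbhd, Set.mem_insert_iff, mem_neighborSet, hx w, hy w]
  exact or_comm

/-! ### Levels of a rooted tree -/

/-- `ℓ` behaves like the distance to the root `r` of a tree: adjacent vertices are on consecutive
levels, and every vertex has at most one lower neighbour, and at least one unless it is `r`. -/
structure IsLevelling (G : SimpleGraph V) (r : V) (ℓ : V → ℕ) : Prop where
  adj : ∀ {u v}, G.Adj u v → ℓ u = ℓ v + 1 ∨ ℓ v = ℓ u + 1
  lower_unique : ∀ {v u w}, G.Adj v u → G.Adj v w → ℓ u < ℓ v → ℓ w < ℓ v → u = w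
  exists_lower : ∀ {v}, v ≠ r → ∃ u, G.Adj v u ∧ ℓ v = ℓ u + 1

theorem IsTree.isLevelling_dist (hG : G.IsTree) (r : V) : G.IsLevelling r (G.dist r) where
  adj h := hG.dist_eq_dist_add_one_of_adj r h
  lower_unique := by
    -- A shortest path to either lower neighbour extends to a path to `v`, and that path is unique.
    intro v u w hu hw hlu hlw
    have key : ∀ y, G.Adj v y → G.dist r y < G.dist r v →
        ∃ p : G.Walk r v, p.IsPath ∧ p.penultimate = y := by
      intro y hy hly
      obtain ⟨p, hp⟩ := hG.connected.exists_walk_length_eq_dist r y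
      refine ⟨p.concat hy.symm, ?_, by simp⟩
      apply Walk.isPath_of_length_eq_dist
      rw [Walk.length_concat, hp]
      rcases hG.dist_eq_dist_add_one_of_adj r hy with h | h <;> omega
    obtain ⟨p, hp, rfl⟩ := key u hu hlu
    obtain ⟨q, hq, rfl⟩ := key w hw hlw
    rw [(hG.existsUnique_path r v).unique hp hq]
  exists_lower := by
    intro v hv
    obtain ⟨p, hp⟩ := hG.connected.exists_walk_length_eq_dist r v
    have hnil : ¬ p.Nil := fun h => hv h.eq.symm
    refine ⟨p.penultimate, (p.adj_penultimate hnil).symm, ?_⟩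
    have h1 := dist_le p.dropLast
    have h2 : p.dropLast.length + 1 = p.length := Walk.length_dropLast_add_one hnil
    rcases hG.dist_eq_dist_add_one_of_adj r (p.adj_penultimate hnil) with h | h <;> omega

namespace IsLevelling

variable {r : V} {ℓ : V → ℕ}

theorem not_triangle (h : G.IsLevelling r ℓ) {u v w : V} (huv : G.Adj u v) (hvw : G.Adj v w) :
    ¬ G.Adj u w := by
  intro huw
  have := h.adj huv
  have := h.adj hvw
  have := h.adj huw
  omega

theorem eq_of_adj_of_adj (h : G.IsLevelling r ℓ) {u v a b : V} (huv : u ≠ v) (hua : G.Adj u a)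
    (hva : G.Adj v a) (hub : G.Adj u b) (hvb : G.Adj v b) : a = b := by
  -- A vertex of a 4-cycle with maximal level would have two lower neighbours.
  have h1 := h.adj hua
  have h2 := h.adj hva
  have h3 := h.adj hub
  have h4 := h.adj hvb
  by_contra hab
  have ku : ¬ (ℓ a < ℓ u ∧ ℓ b < ℓ u) := fun k => hab (h.lower_unique hua hub k.1 k.2)
  have kv : ¬ (ℓ a < ℓ v ∧ ℓ b < ℓ v) := fun k => hab (h.lower_unique hva hvb k.1 k.2)
  have ka : ¬ (ℓ u < ℓ a ∧ ℓ v < ℓ a) :=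
    fun k => huv (h.lower_unique hua.symm hva.symm k.1 k.2)
  have kb : ¬ (ℓ u < ℓ b ∧ ℓ v < ℓ b) :=
    fun k => huv (h.lower_unique hub.symm hvb.symm k.1 k.2)
  omega

/-- The complement of an independent set is a code if it induces no component with fewer than
three vertices. -/
theorem isCode_of_onPath3 (h : G.IsLevelling r ℓ) (htwin : G.TwinFree)
    (hnb : ∀ v, ∃ w, G.Adj v w) {C : Finset V}
    (hind : ∀ u v, u ∉ C → v ∉ C → ¬ G.Adj u v)
    (hpath : ∀ v ∈ C, G.OnPath3 (C : Set V) v) :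
    G.IsTotalDominatingIdentifyingCode C := by
  have hdom : G.IsTotalDominatingSet C := by
    intro v
    by_cases hv : v ∈ C
    · simpa using (hpath v hv).exists_adj
    · obtain ⟨w, hw⟩ := hnb v
      exact ⟨w, by_contra fun hw' => hind v w hv hw' hw, hw⟩
  refine ⟨fun u v huv heq => ?_, hdom⟩
  have hI : ∀ w ∈ C, (w = u ∨ G.Adj u w) ↔ (w = v ∨ G.Adj v w) := by
    intro w hw
    have := Set.ext_iff.1 heq w
    simpa [iSet, closedNbhd, hw] using this
  obtain ⟨a, haC, hua⟩ := hdom u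
  obtain ⟨b, hbC, hvb⟩ := hdom v
  by_cases hadj : G.Adj u v
  · -- Here `{u, v}` would be a component of `C`.
    have hu' : ∀ w ∈ C, G.Adj u w → w = v := fun w hw huw =>
      ((hI w hw).1 (Or.inr huw)).resolve_right fun k => h.not_triangle hadj k huw
    have hv' : ∀ w ∈ C, G.Adj v w → w = u := fun w hw hvw =>
      ((hI w hw).2 (Or.inr hvw)).resolve_right fun k => h.not_triangle hadj hvw k
    have huC : u ∈ C := hv' b hbC hvb ▸ hbC
    obtain ⟨x, y, z, hx, hy, hz, hxz, hxy, hyz, rfl | rfl⟩ := hpath u huC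
    · obtain rfl := hu' y hy hxy
      exact hxz (hv' z hz hyz).symm
    · exact hxz ((hu' x hx hxy.symm).trans (hu' z hz hyz).symm)
  · -- Here `u` and `v` would be two leaves at the same vertex.
    have huC : u ∉ C := fun k =>
      ((hI u k).1 (Or.inl rfl)).elim huv fun k' => hadj k'.symm
    have hvC : v ∉ C := fun k =>
      ((hI v k).2 (Or.inl rfl)).elim (fun e => huv e.symm) hadj
    have hcommon : ∀ w, G.Adj u w ↔ G.Adj v w := by
      intro w
      constructor
      · intro k
        have hw : w ∈ C := by_contra fun hw => hind u w huC hw k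
        exact ((hI w hw).1 (Or.inr k)).resolve_left fun e => hadj (e ▸ k)
      · intro k
        have hw : w ∈ C := by_contra fun hw => hind v w hvC hw k
        exact ((hI w hw).2 (Or.inr k)).resolve_left fun e => hadj (e ▸ k).symm
    refine (htwin u v).1 ⟨huv, ?_⟩
    ext w
    exact hcommon w

/-- In the complement of a residue class of levels modulo `4`, only leaves are isolated. -/
theorem isLeafAt_of_isolated (h : G.IsLevelling r ℓ) {s : V} (hr : G.IsLeafAt r s) {i : ℕ} {v : V}
    (hnb : ∀ w, G.Adj v w → ℓ w % 4 = i) : ∃ p, G.IsLeafAt v p := by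
  by_cases hvr : v = r
  · exact ⟨s, hvr ▸ hr⟩
  · obtain ⟨p, hp, hlp⟩ := h.exists_lower hvr
    refine ⟨p, fun w => ⟨fun hw => ?_, fun e => e ▸ hp⟩⟩
    have h1 := hnb p hp
    have h2 := hnb w hw
    have h3 := h.adj hw
    exact h.lower_unique hw hp (by omega) (by omega)

/-- In the complement of a residue class of levels modulo `4`, an edge forming a component has an
end that is a leaf: otherwise the lower neighbour of its lower end and an upper neighbour of its
upper end would be three levels apart. -/
theorem isLeafAt_of_isolated_edge (h : G.IsLevelling r ℓ) {s : V} (hr : G.IsLeafAt r s) {i : ℕ}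
    {u v : V} (huv : G.Adj u v) (hu : ∀ w, G.Adj u w → w ≠ v → ℓ w % 4 = i)
    (hv : ∀ w, G.Adj v w → w ≠ u → ℓ w % 4 = i) : G.IsLeafAt u v ∨ G.IsLeafAt v u := by
  wlog hlt : ℓ v = ℓ u + 1 generalizing u v
  · exact (this huv.symm hv hu ((h.adj huv).resolve_right hlt)).symm
  by_cases hur : u = r
  · subst hur
    obtain rfl := (hr v).1 huv
    exact Or.inl hr
  · obtain ⟨p, hp, hlp⟩ := h.exists_lower hur
    refine Or.inr fun w => ⟨fun hw => ?_, fun e => e ▸ huv.symm⟩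
    by_contra hne
    have h1 := hu p hp (by rintro rfl; omega)
    have h2 := hv w hw hne
    have h3 := h.adj hw
    have h4 : ¬ ℓ w < ℓ v := fun k => hne (h.lower_unique hw huv.symm k (by omega))
    omega

end IsLevelling

/-! ### Exchanging anchors for leaves -/

/-- `x` is a leaf outside `D` with its only neighbour `v` outside `D`, and `{v, x}` is a component
of the complement of `D`. -/
def IsEdgeComponent (G : SimpleGraph V) (D : Finset V) (x v : V) : Prop :=
  G.IsLeafAt x v ∧ x ∉ D ∧ v ∉ D ∧ ∀ w, G.Adj v w → w ≠ x → w ∈ D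

/-- If all components with at most two vertices of the complement of the independent set `D`
contain a leaf of the graph, then `D` can be exchanged for an independent set of at least the same
size whose complement has only components with at least three vertices. -/
theorem exists_independent_onPath3 (htwin : G.TwinFree) [Fintype V] (D : Finset V)
    (hind : ∀ u ∈ D, ∀ v ∈ D, ¬ G.Adj u v)
    (h1 : ∀ v ∉ D, (∀ w, G.Adj v w → w ∈ D) → ∃ p, G.IsLeafAt v p)
    (h2 : ∀ u ∉ D, ∀ v ∉ D, G.Adj u v → (∀ w, G.Adj u w → w ≠ v → w ∈ D) →
      (∀ w, G.Adj v w → w ≠ u → w ∈ D) → G.IsLeafAt u v ∨ G.IsLeafAt v u) :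
    ∃ D' : Finset V, D.card ≤ D'.card ∧ (∀ u ∈ D', ∀ v ∈ D', ¬ G.Adj u v) ∧
      ∀ v ∉ D', G.OnPath3 {w | w ∉ D'} v := by
  classical
  have hleaf : ∀ {v p : V}, G.Adj v p → ¬ G.IsLeafAt v p → ∃ w, G.Adj v w ∧ w ≠ p := by
    intro v p hvp hn
    by_contra! hall
    exact hn fun w => ⟨hall w, fun e => e ▸ hvp⟩
  -- The anchor of an edge component, chosen arbitrarily among the candidates.
  have hanchor : ∀ x, ∃ p, ∀ v, G.IsEdgeComponent D x v → p ∈ D ∧ G.Adj v p := by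
    intro x
    by_cases hx : ∃ v, G.IsEdgeComponent D x v
    · obtain ⟨v, hv⟩ := hx
      have hvx : G.Adj v x := ((hv.1 v).2 rfl).symm
      obtain ⟨p, hp, hpx⟩ := hleaf hvx (htwin.not_isLeafAt_swap hv.1)
      refine ⟨p, fun v' hv' => ?_⟩
      obtain rfl : v' = v := (hv.1 v').1 ((hv'.1 v').2 rfl)
      exact ⟨hv.2.2.2 p hp hpx, hp⟩
    · exact ⟨x, fun v hv => (hx ⟨v, hv⟩).elim⟩
  choose f hf using hanchor
  -- `X₂` and `X₁` are the leaves that enter `D`, and `S₂` and `S₁` are their anchors. Excluding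
  -- leaves at `S₂` from `X₁` leaves every anchor in `S₂` a second neighbour outside `D'`.
  let X₂ : Finset V := {x | ∃ v, G.IsEdgeComponent D x v}
  let S₂ : Finset V := X₂.image f
  let X₁ : Finset V := {x | x ∉ D ∧ ∃ p ∈ D, G.IsLeafAt x p ∧ p ∉ S₂}
  let S₁ : Finset V := {p | p ∈ D ∧ ∃ x ∈ X₁, G.IsLeafAt x p}
  have mem_X₂ : ∀ {x}, x ∈ X₂ ↔ ∃ v, G.IsEdgeComponent D x v := by simp [X₂]
  have mem_X₁ : ∀ {x}, x ∈ X₁ ↔ x ∉ D ∧ ∃ p ∈ D, G.IsLeafAt x p ∧ p ∉ S₂ := by simp [X₁]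
  have mem_S₂ : ∀ {p}, p ∈ S₂ ↔ ∃ x ∈ X₂, f x = p := by simp [S₂]
  have mem_S₁ : ∀ {p}, p ∈ S₁ ↔ p ∈ D ∧ ∃ x ∈ X₁, G.IsLeafAt x p := by simp [S₁]
  let D' : Finset V := (D \ (S₁ ∪ S₂)) ∪ (X₁ ∪ X₂)
  have mem_D' : ∀ {v}, v ∈ D' ↔ (v ∈ D ∧ v ∉ S₁ ∧ v ∉ S₂) ∨ v ∈ X₁ ∨ v ∈ X₂ := by simp [D']
  -- Where the neighbour of a leaf in `X₁` or `X₂` lies.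
  have hX₁ : ∀ {x w}, x ∈ X₁ → G.Adj x w → w ∈ S₁ ∧ w ∈ D ∧ w ∉ S₂ ∧ G.IsLeafAt x w := by
    intro x w hx hxw
    obtain ⟨-, p, hpD, hp, hpS⟩ := mem_X₁.1 hx
    obtain rfl := (hp w).1 hxw
    exact ⟨mem_S₁.2 ⟨hpD, x, hx, hp⟩, hpD, hpS, hp⟩
  have hX₂ : ∀ {x w}, x ∈ X₂ → G.Adj x w → G.IsEdgeComponent D x w := by
    intro x w hx hxw
    obtain ⟨v, hv⟩ := mem_X₂.1 hx
    obtain rfl := (hv.1 w).1 hxw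
    exact hv
  have hX₁D : ∀ {x}, x ∈ X₁ → x ∉ D := fun hx => (mem_X₁.1 hx).1
  have hX₂D : ∀ {x}, x ∈ X₂ → x ∉ D := fun hx => (mem_X₂.1 hx).elim fun v hv => hv.2.1
  have hS₂ : ∀ {x v}, G.IsEdgeComponent D x v → f x ∈ S₂ := fun hv =>
    mem_S₂.2 ⟨_, mem_X₂.2 ⟨_, hv⟩, rfl⟩
  have hSD : S₁ ∪ S₂ ⊆ D := by
    intro p hp
    rcases Finset.mem_union.1 hp with hp | hp
    · exact (mem_S₁.1 hp).1
    · obtain ⟨x, hx, rfl⟩ := mem_S₂.1 hp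
      obtain ⟨v, hv⟩ := mem_X₂.1 hx
      exact (hf x v hv).1
  -- The centre of an edge component is no leaf, so it stays outside `D'`, as do the anchors.
  have hmid : ∀ {x v}, G.IsEdgeComponent D x v → v ∉ D' := by
    intro x v hv hv'
    have hvx : G.Adj v x := ((hv.1 v).2 rfl).symm
    rcases mem_D'.1 hv' with h | h | h
    · exact hv.2.2.1 h.1
    · exact hv.2.1 (hX₁ h hvx).2.1
    · exact htwin.not_isLeafAt_swap hv.1 (hX₂ h hvx).1
  have hanc : ∀ {p}, p ∈ S₁ ∪ S₂ → p ∉ D' := by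
    intro p hp hp'
    rcases mem_D'.1 hp' with h | h | h
    · exact (Finset.mem_union.1 hp).elim h.2.1 h.2.2
    · exact hX₁D h (hSD hp)
    · exact hX₂D h (hSD hp)
  -- An anchor of an edge component keeps a second neighbour outside `D'`.
  have hS₂path : ∀ {x v}, G.IsEdgeComponent D x v → ∃ u, u ≠ v ∧ G.Adj (f x) u ∧ u ∉ D' := by
    intro x v hv
    obtain ⟨hpD, hvp⟩ := hf x v hv
    have hnl : ¬ G.IsLeafAt (f x) v := fun k =>
      hv.2.1 (htwin.eq_of_isLeafAt hv.1 k ▸ hpD)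
    obtain ⟨u, hu, huv⟩ := hleaf hvp.symm hnl
    refine ⟨u, huv, hu, fun hu' => ?_⟩
    rcases mem_D'.1 hu' with h | h | h
    · exact hind _ hpD u h.1 hu
    · exact (hX₁ h hu.symm).2.2.1 (hS₂ hv)
    · exact (hX₂ h hu.symm).2.2.1 hpD
  have hmidpath : ∀ {x v}, G.IsEdgeComponent D x v →
      G.OnPath3 {w | w ∉ D'} (f x) ∧ G.OnPath3 {w | w ∉ D'} v := by
    intro x v hv
    obtain ⟨u, huv, hu, hu'⟩ := hS₂path hv
    have hp' : f x ∉ D' := hanc (Finset.mem_union_right _ (hS₂ hv))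
    have hvp := (hf x v hv).2
    exact ⟨⟨v, f x, u, hmid hv, hp', hu', huv.symm, hvp, hu, Or.inr rfl⟩,
      ⟨v, f x, u, hmid hv, hp', hu', huv.symm, hvp, hu, Or.inl rfl⟩⟩
  -- Components with at least three vertices are untouched.
  have hkeep : ∀ a b c, a ∉ D → b ∉ D → c ∉ D → a ≠ c → G.Adj a b → G.Adj b c →
      a ∉ D' ∧ b ∉ D' := by
    intro a b c ha hb hc hac hab hbc
    constructor
    · intro h
      rcases mem_D'.1 h with h | h | h
      · exact ha h.1
      · exact hb (hX₁ h hab).2.1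
      · exact hc ((hX₂ h hab).2.2.2 c hbc hac.symm)
    · intro h
      rcases mem_D'.1 h with h | h | h
      · exact hb h.1
      · exact hc (hX₁ h hbc).2.1
      · exact hac (((hX₂ h hbc).1 a).1 hab.symm)
  have hgood : ∀ v, G.OnPath3 {w | w ∉ D} v → G.OnPath3 {w | w ∉ D'} v := by
    rintro v ⟨a, b, c, ha, hb, hc, hac, hab, hbc, hv⟩
    have hk := hkeep a b c ha hb hc hac hab hbc
    have hk' := hkeep c b a hc hb ha hac.symm hbc.symm hab.symm
    exact ⟨a, b, c, hk.1, hk.2, hk'.1, hac, hab, hbc, hv⟩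
  -- A vertex outside `D` lies in a large component, or is isolated, or lies in an edge component.
  have hcases : ∀ v ∉ D, G.OnPath3 {w | w ∉ D} v ∨ (∀ w, G.Adj v w → w ∈ D) ∨
      (∃ u, G.IsEdgeComponent D v u) ∨ ∃ u, G.IsEdgeComponent D u v := by
    intro v hv
    by_cases hiso : ∀ w, G.Adj v w → w ∈ D
    · exact Or.inr (Or.inl hiso)
    push Not at hiso
    obtain ⟨u, hvu, hu⟩ := hiso
    by_cases hvn : ∀ w, G.Adj v w → w ≠ u → w ∈ D
    · by_cases hun : ∀ w, G.Adj u w → w ≠ v → w ∈ D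
      · rcases h2 v hv u hu hvu hvn hun with h | h
        · exact Or.inr (Or.inr (Or.inl ⟨u, h, hv, hu, hun⟩))
        · exact Or.inr (Or.inr (Or.inr ⟨u, h, hu, hv, hvn⟩))
      · push Not at hun
        obtain ⟨w, huw, hwv, hw⟩ := hun
        exact Or.inl ⟨v, u, w, hv, hu, hw, hwv.symm, hvu, huw, Or.inl rfl⟩
    · push Not at hvn
      obtain ⟨w, hvw, hwu, hw⟩ := hvn
      exact Or.inl ⟨u, v, w, hu, hv, hw, hwu.symm, hvu.symm, hvw, Or.inr rfl⟩
  refine ⟨D', ?_, ?_, ?_⟩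
  · have hS₁X₁ : S₁.card ≤ X₁.card := by
      refine Finset.card_le_card_of_forall_subsingleton (fun p x => G.IsLeafAt x p)
        (fun p hp => (mem_S₁.1 hp).2) ?_
      intro x _ p hp q hq
      exact (hq.2 p).1 ((hp.2 p).2 rfl)
    have hS₂X₂ : S₂.card ≤ X₂.card := Finset.card_image_le
    have hdisj : Disjoint X₁ X₂ := Finset.disjoint_left.2 fun x hx hx' => by
      obtain ⟨v, hv⟩ := mem_X₂.1 hx'
      exact hv.2.2.1 (hX₁ hx ((hv.1 v).2 rfl)).2.1
    have hdisj' : Disjoint (D \ (S₁ ∪ S₂)) (X₁ ∪ X₂) := Finset.disjoint_left.2 fun x hx hx' =>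
      (Finset.mem_union.1 hx').elim (fun h => hX₁D h (Finset.mem_sdiff.1 hx).1)
        fun h => hX₂D h (Finset.mem_sdiff.1 hx).1
    have hcard : D'.card = (D \ (S₁ ∪ S₂)).card + (X₁.card + X₂.card) := by
      rw [← Finset.card_union_of_disjoint hdisj, ← Finset.card_union_of_disjoint hdisj']
    have := Finset.card_sdiff_add_card_eq_card hSD
    have := Finset.card_union_le S₁ S₂
    omega
  · intro u hu v hv huv
    rcases mem_D'.1 hu with h | h | h
    · rcases mem_D'.1 hv with h' | h' | h'
      · exact hind u h.1 v h'.1 huv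
      · exact h.2.1 (hX₁ h' huv.symm).1
      · exact (hX₂ h' huv.symm).2.2.1 h.1
    · exact hanc (Finset.mem_union_left _ (hX₁ h huv).1) hv
    · exact hmid (hX₂ h huv) hv
  · intro v hv
    by_cases hvD : v ∈ D
    · by_cases hv₂ : v ∈ S₂
      · obtain ⟨x, hx, rfl⟩ := mem_S₂.1 hv₂
        obtain ⟨m, hm⟩ := mem_X₂.1 hx
        exact (hmidpath hm).1
      · -- `v` is the anchor of a leaf `x ∈ X₁` only. Another neighbour `u` stays outside
        -- `D'`, and its component, or the anchor of its component, supplies the third vertex.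
        have hv₁ : v ∈ S₁ := by_contra fun hv₁ => hv (mem_D'.2 (Or.inl ⟨hvD, hv₁, hv₂⟩))
        obtain ⟨-, x, hx, hxv⟩ := mem_S₁.1 hv₁
        obtain ⟨u, hvu, hux⟩ := hleaf ((hxv v).2 rfl).symm (htwin.not_isLeafAt_swap hxv)
        have huD : u ∉ D := fun k => hind v hvD u k hvu
        rcases hcases u huD with h | h | ⟨m, hm⟩ | ⟨y, hy⟩
        · obtain ⟨a, b, c, ha, hb, hc, hac, hab, hbc, hu⟩ := h
          have hk := hkeep a b c ha hb hc hac hab hbc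
          have hk' := hkeep c b a hc hb ha hac.symm hbc.symm hab.symm
          rcases hu with rfl | rfl
          · exact ⟨v, u, b, hv, hk.1, hk.2, fun e => hb (e ▸ hvD), hvu, hab, Or.inl rfl⟩
          · exact ⟨v, u, c, hv, hk.2, hk'.1, fun e => hc (e ▸ hvD), hvu, hbc, Or.inl rfl⟩
        · obtain ⟨p, hp⟩ := h1 u huD h
          obtain rfl := (hp v).1 hvu.symm
          exact (hux (htwin.eq_of_isLeafAt hp hxv)).elim
        · exact (hm.2.2.1 ((hm.1 v).1 hvu.symm ▸ hvD)).elim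
        · obtain ⟨-, hup⟩ := hf y u hy
          have hpS := hS₂ hy
          exact ⟨v, u, f y, hv, hmid hy, hanc (Finset.mem_union_right _ hpS),
            fun e => hv₂ (e ▸ hpS), hvu, hup, Or.inl rfl⟩
    · rcases hcases v hvD with h | h | ⟨m, hm⟩ | ⟨x, hx⟩
      · exact hgood v h
      · obtain ⟨p, hp⟩ := h1 v hvD h
        have hvp := (hp p).2 rfl
        have hpS : p ∈ S₂ := by_contra fun k =>
          hv (mem_D'.2 (Or.inr (Or.inl (mem_X₁.2 ⟨hvD, p, h p hvp, hp, k⟩))))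
        obtain ⟨x, hx, rfl⟩ := mem_S₂.1 hpS
        obtain ⟨m, hm⟩ := mem_X₂.1 hx
        have hpm := (hf x m hm).2.symm
        refine ⟨v, f x, m, hv, hanc (Finset.mem_union_right _ hpS), hmid hm, ?_, hvp, hpm,
          Or.inl rfl⟩
        rintro rfl
        exact hm.2.1 (h x ((hm.1 v).2 rfl).symm)
      · exact (hv (mem_D'.2 (Or.inr (Or.inr (mem_X₂.2 ⟨m, hm⟩))))).elim
      · exact (hmidpath hx).2

end SimpleGraph

/-! ### Choosing a residue class -/

theorem mainTheorem3 {V : Type*} [Fintype V] (T : SimpleGraph V) (hT : T.IsTree)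
    (htwin : T.TwinFree) (hn : 3 ≤ Fintype.card V) :
    (∃ C : Finset V, T.IsTotalDominatingIdentifyingCode C) ∧
      (T.totalDominatingIdentifyingNumber : ℝ) ≤ 3 * (Fintype.card V : ℝ) / 4 := by
  classical
  have : Nontrivial V := Fintype.one_lt_card_iff_nontrivial.1 (by omega)
  have hnb : ∀ v, ∃ w, T.Adj v w := fun v => hT.connected.preconnected.exists_adj_of_nontrivial v
  obtain ⟨r, hr⟩ := hT.exists_vert_degree_one_of_nontrivial
  obtain ⟨s, hrs, hs⟩ := T.degree_eq_one_iff_existsUnique_adj.1 hr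
  have hleaf : T.IsLeafAt r s := fun w => ⟨hs w, fun e => e ▸ hrs⟩
  have hlev := hT.isLevelling_dist r
  set ℓ := T.dist r
  obtain ⟨i, hi⟩ : ∃ i, Fintype.card V ≤ 4 * (Finset.univ.filter fun v => ℓ v % 4 = i).card := by
    have hmaps : ∀ v ∈ (Finset.univ : Finset V), ℓ v % 4 ∈ Finset.range 4 :=
      fun v _ => Finset.mem_range.2 (Nat.mod_lt _ (by norm_num))
    have hsum := Finset.card_eq_sum_card_fiberwise hmaps
    by_contra! hlt
    have := hlt 0
    have := hlt 1
    have := hlt 2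
    have := hlt 3
    simp only [Finset.sum_range_succ, Finset.sum_range_zero, Finset.card_univ] at hsum
    omega
  obtain ⟨D, hcard, hind, hpath⟩ := T.exists_independent_onPath3 htwin
    (Finset.univ.filter fun v => ℓ v % 4 = i)
    (by
      intro u hu v hv huv
      have := hlev.adj huv
      simp only [Finset.mem_filter, Finset.mem_univ, true_and] at hu hv
      omega)
    (fun v _ hv => hlev.isLeafAt_of_isolated hleaf (i := i) (by simpa using hv))
    (fun u _ v _ huv hu hv =>
      hlev.isLeafAt_of_isolated_edge hleaf (i := i) huv (by simpa using hu) (by simpa using hv))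
  have hcode : T.IsTotalDominatingIdentifyingCode Dᶜ :=
    hlev.isCode_of_onPath3 htwin hnb
      (fun u v hu hv => hind u (by simpa using hu) v (by simpa using hv))
      (by simpa [Set.compl_def] using hpath)
  refine ⟨⟨_, hcode⟩, ?_⟩
  have hle : T.totalDominatingIdentifyingNumber ≤ Dᶜ.card := Nat.sInf_le ⟨_, hcode, rfl⟩
  have hsum := Finset.card_add_card_compl D
  have : 4 * T.totalDominatingIdentifyingNumber ≤ 3 * Fintype.card V := by omega
  rw [le_div_iff₀ (by norm_num)]
  exact_mod_cast (by omega : T.totalDominatingIdentifyingNumber * 4 ≤ 3 * Fintype.card V)
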